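/- Let $\Omega\subset\mathbb{C}^n$ be a bounded domain (nonempty, open, connected) with $C^\infty$ boundary, and let $\delta_\Omega(z)=\operatorname{dist}(z,\partial\Omega)$ denote the Euclidean distance to the boundary. Write $C^\infty(\overline\Omega)$ for the functions that are smooth on $\Omega$ and all of whose derivatives extend continuously to $\overline\Omega$. Let $\delta\in C^\infty(\overline\Omega)$ be a real-valued function that is positive on $\Omega$ and equals $\delta_\Omega$ on $U\cap\Omega$ for some neighborhood $U$ of $\partial\Omega$. Then for every real $\alpha>-1$, every positive integer $k$ and every complex-valued $g\in C^\infty(\overline\Omega)$ there exists a function $\omega\in L^\infty(\Omega)$ such that, for every holomorphic function $h$ on $\Omega$ with $h\delta^\alpha\in L^1(\Omega)$, the functions $hg\delta^\alpha$ and $h\omega\delta^k$ are in $L^1(\Omega)$ and \[ \int_\Omega h\,g\,\delta^\alpha=\int_\Omega h\,\omega\,\delta^k , \] where all integrals are with respect to Lebesgue measure on $\mathbb{C}^n$. -/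

import Mathlib

open MeasureTheory
open scoped ContDiff

/-- The boundary of the set `Ω` in `ℂⁿ` is smooth: near every boundary point, `Ω` is the sublevel
set `{r < 0}` of a real `C^∞` function `r` without critical points. -/
def HasSmoothBoundary {n : ℕ} (Ω : Set (EuclideanSpace ℂ (Fin n))) : Prop :=
  ∀ p ∈ frontier Ω, ∃ (U : Set (EuclideanSpace ℂ (Fin n))) (r : EuclideanSpace ℂ (Fin n) → ℝ),
    IsOpen U ∧ p ∈ U ∧ ContDiffOn ℝ ∞ r U ∧ (∀ z ∈ U, fderiv ℝ r z ≠ 0) ∧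
      Ω ∩ U = {z ∈ U | r z < 0}

/-- A bounded domain (nonempty connected open set) in `ℂⁿ` with smooth boundary. -/
structure IsSmoothBoundedDomain {n : ℕ} (Ω : Set (EuclideanSpace ℂ (Fin n))) : Prop where
  isOpen : IsOpen Ω
  isConnected : IsConnected Ω
  isBounded : Bornology.IsBounded Ω
  smoothBoundary : HasSmoothBoundary Ω

/-- `f ∈ C^∞(Ω̄)` for an open set `Ω`: `f` is (real) smooth on `Ω` and its derivatives of all orders
extend continuously to the closure of `Ω`. Only the values of `f` on `Ω` matter. -/
def SmoothUpToBoundary {n : ℕ} {F : Type*} [NormedAddCommGroup F] [NormedSpace ℝ F]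
    (Ω : Set (EuclideanSpace ℂ (Fin n))) (f : EuclideanSpace ℂ (Fin n) → F) : Prop :=
  ContDiffOn ℝ ∞ f Ω ∧
    ∀ m : ℕ, ∃ G : EuclideanSpace ℂ (Fin n) →
        ContinuousMultilinearMap ℝ (fun _ : Fin m => EuclideanSpace ℂ (Fin n)) F,
      ContinuousOn G (closure Ω) ∧ Set.EqOn (iteratedFDeriv ℝ m f) G Ω

/-- The Euclidean distance to the boundary of `Ω`. -/
noncomputable def boundaryDist {n : ℕ} (Ω : Set (EuclideanSpace ℂ (Fin n)))
    (z : EuclideanSpace ℂ (Fin n)) : ℝ :=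
  Metric.infDist z (frontier Ω)

/-! Near the boundary `δ` is the distance function, so `|∇δ|² = 1` there. Split `g = g|∇δ|² + g(1 -
|∇δ|²)`. The second summand vanishes where `δ` is small; on the rest of `Ω` the quotient `δ^(α-k)`
is bounded, so this summand can be moved directly to the weight `δ^k`.

For the first summand write `D_j = ∂/∂x_j + i ∂/∂y_j` and `F_j = g · conj(D_j δ)`, so that `∑ F_j
D_j δ = g|∇δ|²`. Since `D_j h = 0`, integrating `h D_j(δ^(α+1) F_j)` gives zero, the boundary term
being killed by `δ^(α+1)`. Summing over `j` trades `g|∇δ|² δ^α` for `-(α+1)⁻¹ (∑ D_j F_j) δ^(α+1)`,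
whose coefficient does not depend on `h` and again has bounded derivatives of all orders. Repeating
this until the exponent is at least `k` yields a bounded `ω`.

Since `h` is only weighted integrable, the vanishing of the boundary term is obtained by truncating
`δ^(α+1)` (`exists_truncated_rpow`) and passing to the limit
(`setIntegral_holomorphic_mul_dbar_weight_eq_zero`). The exchange of weights is
`exists_setIntegral_gradSq_weight_eq`; the induction is `exists_memLp_top_setIntegral_weight_eq`. -/

/-! ### Functions with bounded derivatives of all orders -/

section BoundedSmooth

variable {E F G : Type*} [NormedAddCommGroup E] [NormedSpace ℝ E] [NormedAddCommGroup F]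
  [NormedSpace ℝ F] [NormedAddCommGroup G] [NormedSpace ℝ G]

/-- `f` is smooth on `Ω` and its derivatives of all orders are bounded on `Ω`. -/
def BoundedSmoothOn (Ω : Set E) (f : E → F) : Prop :=
  ContDiffOn ℝ ∞ f Ω ∧ ∀ m : ℕ, ∃ C, ∀ z ∈ Ω, ‖iteratedFDerivWithin ℝ m f Ω z‖ ≤ C

variable {Ω : Set E}

theorem BoundedSmoothOn.exists_bound {f : E → F} (hf : BoundedSmoothOn Ω f) :
    ∃ C, 0 ≤ C ∧ ∀ z ∈ Ω, ‖f z‖ ≤ C := by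
  obtain ⟨C, hC⟩ := hf.2 0
  refine ⟨max C 0, le_max_right _ _, fun z hz => le_max_of_le_left ?_⟩
  simpa using hC z hz

theorem BoundedSmoothOn.congr {f f' : E → F} (hf : BoundedSmoothOn Ω f) (h : Set.EqOn f' f Ω) :
    BoundedSmoothOn Ω f' := by
  refine ⟨hf.1.congr h, fun m => ?_⟩
  obtain ⟨C, hC⟩ := hf.2 m
  refine ⟨C, fun z hz => ?_⟩
  rw [iteratedFDerivWithin_congr h hz]
  exact hC z hz

theorem BoundedSmoothOn.clm_comp {f : E → F} (hΩ : IsOpen Ω) (hf : BoundedSmoothOn Ω f)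
    (L : F →L[ℝ] G) : BoundedSmoothOn Ω (fun z => L (f z)) := by
  refine ⟨L.contDiff.comp_contDiffOn hf.1, fun m => ?_⟩
  obtain ⟨C, hC⟩ := hf.2 m
  refine ⟨‖L‖ * C, fun z hz => ?_⟩
  refine (L.norm_iteratedFDerivWithin_comp_left (N := ∞) (hf.1 z hz) hΩ.uniqueDiffOn hz
    (by exact_mod_cast le_top)).trans ?_
  gcongr
  exact hC z hz

theorem BoundedSmoothOn.add {f f' : E → F} (hΩ : IsOpen Ω) (hf : BoundedSmoothOn Ω f)
    (hf' : BoundedSmoothOn Ω f') : BoundedSmoothOn Ω (fun z => f z + f' z) := by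
  refine ⟨hf.1.add hf'.1, fun m => ?_⟩
  obtain ⟨C, hC⟩ := hf.2 m
  obtain ⟨C', hC'⟩ := hf'.2 m
  refine ⟨C + C', fun z hz => ?_⟩
  have hm : (m : ℕ∞ω) ≤ ∞ := by exact_mod_cast le_top
  have := fun_iteratedFDerivWithin_add_apply (𝕜 := ℝ) (i := m) ((hf.1 z hz).of_le hm)
    ((hf'.1 z hz).of_le hm) hΩ.uniqueDiffOn hz
  rw [this]
  exact (norm_add_le _ _).trans (add_le_add (hC z hz) (hC' z hz))

theorem BoundedSmoothOn.mul {f f' : E → ℂ} (hΩ : IsOpen Ω) (hf : BoundedSmoothOn Ω f)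
    (hf' : BoundedSmoothOn Ω f') : BoundedSmoothOn Ω (fun z => f z * f' z) := by
  refine ⟨hf.1.mul hf'.1, fun m => ?_⟩
  choose C hC using hf.2
  choose C' hC' using hf'.2
  refine ⟨∑ i ∈ Finset.range (m + 1), (m.choose i : ℝ) * C i * C' (m - i), fun z hz => ?_⟩
  refine (norm_iteratedFDerivWithin_mul_le hf.1 hf'.1 hΩ.uniqueDiffOn hz
    (by exact_mod_cast le_top)).trans ?_
  refine Finset.sum_le_sum fun i _ => ?_
  have := (norm_nonneg _).trans (hC i z hz)
  gcongr
  · exact hC i z hz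
  · exact hC' _ z hz

theorem BoundedSmoothOn.fderiv_apply {f : E → F} (hΩ : IsOpen Ω) (hf : BoundedSmoothOn Ω f)
    (v : E) : BoundedSmoothOn Ω (fun z => fderiv ℝ f z v) := by
  have h1 : BoundedSmoothOn Ω (fderivWithin ℝ f Ω) := by
    refine ⟨hf.1.fderivWithin hΩ.uniqueDiffOn (by simp), fun m => ?_⟩
    obtain ⟨C, hC⟩ := hf.2 (m + 1)
    refine ⟨C, fun z hz => ?_⟩
    rw [norm_iteratedFDerivWithin_fderivWithin hΩ.uniqueDiffOn hz]
    exact hC z hz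
  refine (h1.clm_comp hΩ (ContinuousLinearMap.apply ℝ F v)).congr fun z hz => ?_
  simp [fderivWithin_of_isOpen hΩ hz]

theorem BoundedSmoothOn.const_mul {f : E → ℂ} (hΩ : IsOpen Ω) (hf : BoundedSmoothOn Ω f) (c : ℂ) :
    BoundedSmoothOn Ω (fun z => c * f z) :=
  hf.clm_comp hΩ (ContinuousLinearMap.mul ℝ ℂ c)

theorem BoundedSmoothOn.ofReal {f : E → ℝ} (hΩ : IsOpen Ω) (hf : BoundedSmoothOn Ω f) :
    BoundedSmoothOn Ω (fun z => (f z : ℂ)) :=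
  hf.clm_comp hΩ Complex.ofRealCLM

theorem BoundedSmoothOn.sum {ι : Type*} (s : Finset ι) {f : ι → E → F} (hΩ : IsOpen Ω)
    (hf : ∀ i ∈ s, BoundedSmoothOn Ω (f i)) : BoundedSmoothOn Ω (fun z => ∑ i ∈ s, f i z) := by
  classical
  induction s using Finset.induction_on with
  | empty =>
    refine ⟨by simpa using contDiffOn_const, fun m => ⟨0, fun z _ => ?_⟩⟩
    simp
  | insert i s hi ih =>
    simp only [Finset.sum_insert hi]
    exact (hf i (by simp)).add hΩ (ih fun j hj => hf j (by simp [hj]))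

end BoundedSmooth

/-- The closure of `Ω` is compact, so a continuous extension bounds each derivative. Only these
bounds, never the boundary values, enter the rest of the argument. -/
theorem SmoothUpToBoundary.boundedSmoothOn {n : ℕ} {F : Type*} [NormedAddCommGroup F]
    [NormedSpace ℝ F] {Ω : Set (EuclideanSpace ℂ (Fin n))} {f : EuclideanSpace ℂ (Fin n) → F}
    (hΩ : IsOpen Ω) (hb : Bornology.IsBounded Ω) (hf : SmoothUpToBoundary Ω f) :
    BoundedSmoothOn Ω f := by
  refine ⟨hf.1, fun m => ?_⟩
  obtain ⟨G, hG, hGf⟩ := hf.2 m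
  obtain ⟨C, hC⟩ := hb.isCompact_closure.exists_bound_of_continuousOn hG
  refine ⟨C, fun z hz => ?_⟩
  rw [iteratedFDerivWithin_of_isOpen m hΩ hz, hGf hz]
  exact hC z (subset_closure hz)

/-! ### Truncated powers -/

/-- Smooth truncations of `t ↦ t ^ (α + 1)` near `0`, with derivatives controlled by `t ^ α`. -/
theorem exists_truncated_rpow {α : ℝ} (hα : -1 < α) :
    ∃ (C : ℝ) (θ : ℕ → ℝ → ℝ), 0 ≤ C ∧ (∀ m, ContDiffOn ℝ 1 (θ m) (Set.Ioi 0)) ∧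
      (∀ m, ∃ ε > 0, ∀ t < ε, θ m t = 0) ∧
      (∀ m t, 0 < t → |θ m t| ≤ t ^ (α + 1) ∧ |deriv (θ m) t| ≤ C * t ^ α) ∧
      (∀ t, 0 < t → ∀ᶠ m in Filter.atTop,
        θ m t = t ^ (α + 1) ∧ deriv (θ m) t = (α + 1) * t ^ α) := by
  set s : ℝ → ℝ := Real.smoothTransition with hs
  have hs1 : ContDiff ℝ 1 s := Real.smoothTransition.contDiff
  have hsd : ∀ x, HasDerivAt s (deriv s x) x := fun x =>
    (hs1.differentiable (by simp) x).hasDerivAt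
  have hlow : ∀ x < 0, deriv s x = 0 := fun x hx => by
    have : s =ᶠ[nhds x] fun _ => 0 := by
      filter_upwards [Iio_mem_nhds hx] with y hy
      exact Real.smoothTransition.zero_of_nonpos (le_of_lt hy)
    rw [this.deriv_eq]; simp
  have hhigh : ∀ x > 1, deriv s x = 0 := fun x hx => by
    have : s =ᶠ[nhds x] fun _ => 1 := by
      filter_upwards [Ioi_mem_nhds hx] with y hy
      exact Real.smoothTransition.one_of_one_le (le_of_lt hy)
    rw [this.deriv_eq]; simp
  obtain ⟨B, hB⟩ := (isCompact_Icc (a := (0 : ℝ)) (b := 1)).exists_bound_of_continuousOn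
    (hs1.continuous_deriv le_rfl).continuousOn
  have hB0 : 0 ≤ B := (norm_nonneg _).trans (hB 0 (by simp))
  -- This makes the truncation estimate uniform in `m`: the derivative of the cutoff contributes
  -- `(m+1) s'((m+1)t - 1) t^(α+1) = x s'(x - 1) t^α` with `x = (m+1)t`, and `s'(x - 1)` vanishes
  -- unless `1 ≤ x ≤ 2`.
  have hbd : ∀ x, 0 < x → |x * deriv s (x - 1)| ≤ 2 * B := fun x hx => by
    rcases lt_or_ge (x - 1) 0 with h | h
    · rw [hlow _ h]; simpa using hB0
    rcases lt_or_ge 1 (x - 1) with h' | h'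
    · rw [hhigh _ h']; simpa using hB0
    rw [abs_mul, abs_of_pos hx]
    exact mul_le_mul (by linarith) (hB _ ⟨h, h'⟩) (abs_nonneg _) (by norm_num)
  have hder : ∀ (m : ℕ) (t : ℝ), 0 < t → HasDerivAt
      (fun t => s ((m + 1) * t - 1) * t ^ (α + 1))
      (deriv s ((m + 1) * t - 1) * (m + 1) * t ^ (α + 1) +
        s ((m + 1) * t - 1) * ((α + 1) * t ^ α)) t := fun m t ht => by
    have h1 : HasDerivAt (fun t : ℝ => ((m : ℝ) + 1) * t - 1) (m + 1) t := by
      simpa using ((hasDerivAt_id t).const_mul ((m : ℝ) + 1)).sub_const 1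
    have h2 := Real.hasDerivAt_rpow_const (x := t) (p := α + 1) (Or.inl ht.ne')
    rw [add_sub_cancel_right] at h2
    exact ((hsd _).comp t h1).mul h2
  -- The cutoff factor is `0` for `t ≤ 1/(m+1)` and `1` for `t ≥ 2/(m+1)`. In the constant, `2B`
  -- comes from differentiating the cutoff and `α + 1` from differentiating the power.
  refine ⟨2 * B + (α + 1), fun m t => s ((m + 1) * t - 1) * t ^ (α + 1), by linarith,
    fun m => ?_, fun m => ⟨1 / (m + 1), by positivity, fun t ht => ?_⟩, fun m t ht => ⟨?_, ?_⟩,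
    fun t ht => ?_⟩
  · refine ContDiffOn.mul ?_ ?_
    · exact (hs1.comp (by fun_prop)).contDiffOn
    · exact fun t ht => (Real.contDiffAt_rpow_const_of_ne (ne_of_gt ht)).contDiffWithinAt
  · have : s ((m + 1) * t - 1) = 0 := by
      apply Real.smoothTransition.zero_of_nonpos
      rw [lt_div_iff₀ (by positivity)] at ht
      linarith
    simp [this]
  · rw [abs_mul, abs_of_pos (Real.rpow_pos_of_pos ht _), abs_of_nonneg
      (Real.smoothTransition.nonneg _)]
    exact mul_le_of_le_one_left (Real.rpow_pos_of_pos ht _).le (Real.smoothTransition.le_one _)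
  · rw [(hder m t ht).deriv]
    have e : t ^ (α + 1) = t * t ^ α := by rw [Real.rpow_add ht, Real.rpow_one, mul_comm]
    have hp := Real.rpow_pos_of_pos ht α
    have hx := hbd ((m + 1) * t) (by positivity)
    calc _ = |(((m + 1) * t) * deriv s ((m + 1) * t - 1)) * t ^ α
          + s ((m + 1) * t - 1) * ((α + 1) * t ^ α)| := by rw [e]; congr 1; ring
      _ ≤ 2 * B * t ^ α + 1 * ((α + 1) * t ^ α) := by
        refine (abs_add_le _ _).trans (add_le_add ?_ ?_)
        · rw [abs_mul, abs_of_pos hp]; gcongr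
        · have : 0 ≤ (α + 1) * t ^ α := mul_nonneg (by linarith) hp.le
          rw [abs_mul, abs_of_nonneg this, abs_of_nonneg (Real.smoothTransition.nonneg _)]
          gcongr
          exact Real.smoothTransition.le_one _
      _ = _ := by ring
  · obtain ⟨N, hN⟩ := exists_nat_gt (2 / t)
    filter_upwards [Filter.eventually_ge_atTop N] with m hm
    have h2 : 1 < (m + 1) * t - 1 := by
      have : 2 / t < m + 1 := by
        have : (N : ℝ) ≤ m := by exact_mod_cast hm
        linarith
      rw [div_lt_iff₀ ht] at this
      linarith
    rw [(hder m t ht).deriv, hhigh _ h2, show s ((m + 1) * t - 1) = 1 from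
      Real.smoothTransition.one_of_one_le h2.le]
    simp

/-! ### The eikonal equation -/

/-- The squared norm of a real functional on `ℂⁿ` in terms of its values on the standard basis. -/
theorem sum_sq_apply_single_eq_one {n : ℕ} (l : EuclideanSpace ℂ (Fin n) →L[ℝ] ℝ) (hl : ‖l‖ ≤ 1)
    {u : EuclideanSpace ℂ (Fin n)} (hu : ‖u‖ ≤ 1) (hlu : l u = 1) :
    ∑ j, (l (EuclideanSpace.single j 1) ^ 2 +
      l (Complex.I • EuclideanSpace.single j 1) ^ 2) = 1 := by
  set a : Fin n → ℝ := fun j => l (EuclideanSpace.single j 1)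
  set b : Fin n → ℝ := fun j => l (Complex.I • EuclideanSpace.single j 1)
  have hdec : ∀ w : EuclideanSpace ℂ (Fin n), w = ∑ j, ((w j).re • EuclideanSpace.single j (1 : ℂ) +
      (w j).im • (Complex.I • EuclideanSpace.single j (1 : ℂ))) := fun w => by
    ext i
    simp [Finset.sum_add_distrib, Finset.sum_apply, Pi.single_apply, Complex.re_add_im]
  have hlw : ∀ w, l w = ∑ j, ((w j).re * a j + (w j).im * b j) := fun w => by
    conv_lhs => rw [hdec w]
    simp [a, b]
  have hnorm : ∀ w : EuclideanSpace ℂ (Fin n), ‖w‖ ^ 2 = ∑ j, ((w j).re ^ 2 + (w j).im ^ 2) :=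
    fun w => by
      rw [EuclideanSpace.norm_sq_eq]
      exact Finset.sum_congr rfl fun j _ => by rw [Complex.sq_norm, Complex.normSq_apply]; ring
  change ∑ j, (a j ^ 2 + b j ^ 2) = 1
  set S := ∑ j, (a j ^ 2 + b j ^ 2) with hS
  apply le_antisymm
  -- Test `l` on its own gradient `w`: `‖w‖² = S = l w ≤ ‖w‖`, hence `S ≤ 1`.
  · set w : EuclideanSpace ℂ (Fin n) := WithLp.toLp 2 fun j => (⟨a j, b j⟩ : ℂ)
    have h1 : l w = S := by rw [hlw, hS]; simp [w, sq]
    have h2 : ‖w‖ ^ 2 = S := by rw [hnorm]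
    have h3 : l w ≤ ‖w‖ := (le_abs_self _).trans ((l.le_opNorm w).trans
      (mul_le_of_le_one_left (norm_nonneg _) hl))
    rw [h1, ← h2] at h3
    nlinarith [norm_nonneg w]
  -- Conversely `1 = l u ≤ (‖u‖² + S)/2 ≤ (1 + S)/2`.
  · have h1 : ‖u‖ ^ 2 ≤ 1 := pow_le_one₀ (norm_nonneg _) hu
    rw [hnorm] at h1
    have h2 : ∑ j, ((u j).re * a j + (u j).im * b j) ≤
        ∑ j, (((u j).re ^ 2 + (u j).im ^ 2) / 2 + (a j ^ 2 + b j ^ 2) / 2) :=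
      Finset.sum_le_sum fun j _ => by
        nlinarith [sq_nonneg ((u j).re - a j), sq_nonneg ((u j).im - b j)]
    rw [← hlw, hlu, Finset.sum_add_distrib, ← Finset.sum_div, ← Finset.sum_div, ← hS] at h2
    linarith

/-- The eikonal equation for the distance to a closed set. -/
theorem sum_sq_fderiv_eq_one_of_eventuallyEq_infDist {n : ℕ} {S : Set (EuclideanSpace ℂ (Fin n))}
    (hS : IsClosed S) {f : EuclideanSpace ℂ (Fin n) → ℝ} {z : EuclideanSpace ℂ (Fin n)}
    (hf : DifferentiableAt ℝ f z) (hfz : 0 < f z)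
    (heq : f =ᶠ[nhds z] fun y => Metric.infDist y S) :
    ∑ j, (fderiv ℝ f z (EuclideanSpace.single j 1) ^ 2 +
      fderiv ℝ f z (Complex.I • EuclideanSpace.single j 1) ^ 2) = 1 := by
  have hz : f z = Metric.infDist z S := heq.self_of_nhds
  have hne : S.Nonempty := by
    by_contra h
    rw [Set.not_nonempty_iff_eq_empty] at h
    rw [hz, h, Metric.infDist_empty] at hfz
    exact lt_irrefl _ hfz
  obtain ⟨p, hp, hpd⟩ := hS.exists_infDist_eq_dist hne z
  set d := f z with hd
  have hdp : ‖z - p‖ = d := by rw [← dist_eq_norm, ← hpd, hz]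
  refine sum_sq_apply_single_eq_one (fderiv ℝ f z) ?_ (u := d⁻¹ • (z - p)) ?_ ?_
  -- The distance to a set is 1-Lipschitz, which bounds the gradient from above; the bound is
  -- attained in the direction pointing away from a nearest point `p`.
  · refine norm_fderiv_le_of_lip' ℝ zero_le_one ?_
    filter_upwards [heq] with y hy
    rw [hy, ← hd, hz, one_mul, ← dist_eq_norm, ← dist_eq_norm]
    simpa using (Metric.lipschitz_infDist_pt S).dist_le_mul y z
  · rw [norm_smul, hdp, norm_inv, Real.norm_of_nonneg hfz.le, inv_mul_cancel₀ hfz.ne']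
  · have hline : HasDerivAt (fun t : ℝ => f (z + t • (z - p))) (fderiv ℝ f z (z - p)) 0 := by
      have h1 : HasDerivAt (fun t : ℝ => z + t • (z - p)) (z - p) 0 := by
        simpa using ((hasDerivAt_id (0 : ℝ)).smul_const (z - p)).const_add z
      have h2 : HasFDerivAt f (fderiv ℝ f z) (z + (0 : ℝ) • (z - p)) := by
        simpa using hf.hasFDerivAt
      exact h2.comp_hasDerivAt 0 h1
    -- The distance at `z + t(z - p)` is at most the distance to `p`, namely `(1 + t)d`, with
    -- equality at `t = 0`. This holds for both signs of `t` near `0`, so the two derivatives agree.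
    have hmax : IsLocalMax (fun t : ℝ => f (z + t • (z - p)) - (1 + t) * d) 0 := by
      have hc : Filter.Tendsto (fun t : ℝ => z + t • (z - p)) (nhds 0) (nhds z) := by
        have : Continuous fun t : ℝ => z + t • (z - p) := by fun_prop
        simpa using this.tendsto 0
      filter_upwards [hc.eventually heq, Ioi_mem_nhds (show (-1 : ℝ) < 0 by norm_num)] with t ht ht1
      have h3 : Metric.infDist (z + t • (z - p)) S ≤ (1 + t) * d := by
        refine (Metric.infDist_le_dist_of_mem hp).trans (le_of_eq ?_)
        rw [dist_eq_norm, show z + t • (z - p) - p = (1 + t) • (z - p) by module, norm_smul, hdp,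
          Real.norm_of_nonneg (by have : (-1 : ℝ) < t := ht1; linarith)]
      simp only [zero_smul, add_zero, one_mul, ← hd, sub_self]
      rw [ht]
      linarith
    have h4 : HasDerivAt (fun t : ℝ => f (z + t • (z - p)) - (1 + t) * d)
        (fderiv ℝ f z (z - p) - 1 * d) 0 :=
      hline.sub (((hasDerivAt_id (0 : ℝ)).const_add 1).mul_const d)
    have h5 := hmax.hasDerivAt_eq_zero h4
    rw [map_smul, smul_eq_mul, show fderiv ℝ f z (z - p) = d by linarith, inv_mul_cancel₀ hfz.ne']

/-! ### The Cauchy-Riemann operator and integration by parts against holomorphic functions -/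

section Dbar

variable {n : ℕ}

/-- Twice the Cauchy-Riemann operator along the complex line spanned by `v`. -/
noncomputable def dbar (v : EuclideanSpace ℂ (Fin n)) (f : EuclideanSpace ℂ (Fin n) → ℂ)
    (z : EuclideanSpace ℂ (Fin n)) : ℂ :=
  fderiv ℝ f z v + Complex.I * fderiv ℝ f z (Complex.I • v)

theorem BoundedSmoothOn.dbar {Ω : Set (EuclideanSpace ℂ (Fin n))}
    {f : EuclideanSpace ℂ (Fin n) → ℂ} (hΩ : IsOpen Ω) (hf : BoundedSmoothOn Ω f)
    (v : EuclideanSpace ℂ (Fin n)) : BoundedSmoothOn Ω (dbar v f) :=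
  (hf.fderiv_apply hΩ v).add hΩ ((hf.fderiv_apply hΩ _).const_mul hΩ _)

theorem dbar_mul {f g : EuclideanSpace ℂ (Fin n) → ℂ} {z : EuclideanSpace ℂ (Fin n)}
    (hf : DifferentiableAt ℝ f z) (hg : DifferentiableAt ℝ g z) (v : EuclideanSpace ℂ (Fin n)) :
    dbar v (fun y => f y * g y) z = f z * dbar v g z + g z * dbar v f z := by
  simp only [dbar, fderiv_fun_mul hf hg, add_apply, smul_apply,
    smul_eq_mul]
  ring

theorem dbar_eq_zero {h : EuclideanSpace ℂ (Fin n) → ℂ} {z : EuclideanSpace ℂ (Fin n)}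
    (hh : DifferentiableAt ℂ h z) (v : EuclideanSpace ℂ (Fin n)) : dbar v h z = 0 := by
  have : fderiv ℝ h z = (fderiv ℂ h z).restrictScalars ℝ := hh.fderiv_restrictScalars ℝ
  simp only [dbar, this, ContinuousLinearMap.coe_restrictScalars', map_smul, smul_eq_mul]
  rw [← mul_assoc, Complex.I_mul_I]
  ring

theorem dbar_ofReal {f : EuclideanSpace ℂ (Fin n) → ℝ} {z : EuclideanSpace ℂ (Fin n)}
    (hf : DifferentiableAt ℝ f z) (v : EuclideanSpace ℂ (Fin n)) :
    dbar v (fun y => (f y : ℂ)) z =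
      fderiv ℝ f z v + Complex.I * fderiv ℝ f z (Complex.I • v) := by
  have : HasFDerivAt (fun y => (f y : ℂ)) (Complex.ofRealCLM.comp (fderiv ℝ f z)) z :=
    Complex.ofRealCLM.hasFDerivAt.comp z hf.hasFDerivAt
  simp [dbar, this.fderiv]

theorem dbar_ofReal_comp {f : EuclideanSpace ℂ (Fin n) → ℝ} {z : EuclideanSpace ℂ (Fin n)}
    {θ : ℝ → ℝ} (hf : DifferentiableAt ℝ f z) (hθ : DifferentiableAt ℝ θ (f z))
    (v : EuclideanSpace ℂ (Fin n)) :
    dbar v (fun y => (θ (f y) : ℂ)) z = deriv θ (f z) * dbar v (fun y => (f y : ℂ)) z := by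
  have h1 : HasFDerivAt (fun y => θ (f y)) (deriv θ (f z) • fderiv ℝ f z) z :=
    hθ.hasDerivAt.comp_hasFDerivAt z hf.hasFDerivAt
  rw [dbar_ofReal hf, dbar_ofReal h1.differentiableAt, h1.fderiv]
  simp only [smul_apply, smul_eq_mul]
  push_cast
  ring

theorem integral_fderiv_apply_eq_zero {E : Type*} [NormedAddCommGroup E] [NormedSpace ℝ E]
    [MeasurableSpace E] {μ : Measure E} [BorelSpace E] [FiniteDimensional ℝ E]
    [μ.IsAddHaarMeasure] {f : E → ℂ} {v : E} (hf : Differentiable ℝ f)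
    (hfi : Integrable f μ) (hfd : Integrable (fun x => fderiv ℝ f x v) μ) :
    ∫ x, fderiv ℝ f x v ∂μ = 0 := by
  -- Integrating by parts against the constant `1` leaves only the integral of the derivative.
  have := integral_mul_fderiv_eq_neg_fderiv_mul_of_integrable (μ := μ) (f := fun _ => (1 : ℂ))
    (g := f) (v := v) (by simp) (by simpa using hfd) (by simpa using hfi)
    (fun x _ => by fun_prop) (fun x _ => hf x)
  simpa using this

/-- The directional derivatives of a holomorphic function are locally bounded. -/
theorem exists_bound_fderiv_of_differentiableOn {Ω K : Set (EuclideanSpace ℂ (Fin n))}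
    (hΩ : IsOpen Ω) (hK : IsCompact K) (hKΩ : K ⊆ Ω) {h : EuclideanSpace ℂ (Fin n) → ℂ}
    (hh : DifferentiableOn ℂ h Ω) (v : EuclideanSpace ℂ (Fin n)) :
    ∃ C, ∀ z ∈ K, ‖fderiv ℝ h z v‖ ≤ C := by
  obtain ⟨r, hr, hrΩ⟩ := hK.exists_cthickening_subset_open hΩ hKΩ
  obtain ⟨C, hC⟩ := (hK.cthickening (r := r)).exists_bound_of_continuousOn
    (hh.continuousOn.mono hrΩ)
  -- With this radius the disc `z + ζ v`, `|ζ| ≤ R`, stays in the `r`-thickening of `K`, also when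
  -- `v = 0`; the Cauchy estimate on this slice then gives the bound `C / R`.
  set R := r / (‖v‖ + 1) with hR
  have hR0 : 0 < R := by positivity
  refine ⟨C / R, fun z hz => ?_⟩
  have hzd : DifferentiableAt ℂ h z := hh.differentiableAt (hΩ.mem_nhds (hKΩ hz))
  have hmem : ∀ ζ ∈ Metric.closedBall (0 : ℂ) R, z + ζ • v ∈ Metric.cthickening r K := by
    intro ζ hζ
    refine Metric.mem_cthickening_of_dist_le _ z _ _ hz ?_
    rw [dist_eq_norm, add_sub_cancel_left, norm_smul]
    rw [mem_closedBall_zero_iff] at hζ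
    calc ‖ζ‖ * ‖v‖ ≤ R * (‖v‖ + 1) := by gcongr; linarith
      _ = r := by rw [hR]; field_simp
  have hline : ∀ ζ : ℂ, HasDerivAt (fun ζ : ℂ => z + ζ • v) v ζ := fun ζ => by
    simpa using ((hasDerivAt_id ζ).smul_const v).const_add z
  have hcomp : ∀ ζ ∈ Metric.closedBall (0 : ℂ) R,
      HasDerivAt (fun ζ : ℂ => h (z + ζ • v)) (fderiv ℂ h (z + ζ • v) v) ζ := fun ζ hζ =>
    (hh.differentiableAt (hΩ.mem_nhds (hrΩ (hmem ζ hζ)))).hasFDerivAt.comp_hasDerivAt ζ (hline ζ)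
  have h0 := (hcomp 0 (by simp [hR0.le])).deriv
  rw [zero_smul, add_zero] at h0
  have hfd : fderiv ℝ h z v = fderiv ℂ h z v := by
    rw [hzd.fderiv_restrictScalars ℝ]; rfl
  rw [hfd, ← h0]
  refine Complex.norm_deriv_le_of_forall_mem_sphere_norm_le hR0 ?_ fun ζ hζ =>
    hC _ (hmem ζ (Metric.sphere_subset_closedBall hζ))
  refine DifferentiableOn.diffContOnCl fun ζ hζ => ?_
  rw [closure_ball _ hR0.ne'] at hζ
  exact (hcomp ζ hζ).differentiableAt.differentiableWithinAt

/-- `∂̄` of a compactly supported function is orthogonal to holomorphic functions. -/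
theorem setIntegral_holomorphic_mul_dbar_eq_zero {Ω K : Set (EuclideanSpace ℂ (Fin n))}
    (hΩ : IsOpen Ω) (hK : IsCompact K) (hKΩ : K ⊆ Ω) {h u : EuclideanSpace ℂ (Fin n) → ℂ}
    (hh : DifferentiableOn ℂ h Ω) (hu : ContDiffOn ℝ 1 u Ω) (huK : ∀ z ∈ Ω, z ∉ K → u z = 0)
    (v : EuclideanSpace ℂ (Fin n)) : ∫ z in Ω, h z * dbar v u z = 0 := by
  -- The extension of `h u` by zero is differentiable everywhere, because `Ω` and the complement of
  -- `K` are open, cover the space, and `Ψ` is respectively `h u` and `0` on them.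
  set Ψ : EuclideanSpace ℂ (Fin n) → ℂ := Ω.indicator fun z => h z * u z with hΨ
  have hzero : ∀ z ∉ K, Ψ z = 0 := fun z hz => by
    by_cases hzΩ : z ∈ Ω
    · rw [hΨ, Set.indicator_of_mem hzΩ, huK z hzΩ hz, mul_zero]
    · exact Set.indicator_of_notMem hzΩ _
  have hnear : ∀ z ∈ Ω, Ψ =ᶠ[nhds z] fun z => h z * u z := fun z hz => by
    filter_upwards [hΩ.mem_nhds hz] with y hy using Set.indicator_of_mem hy _
  have hoff : ∀ z ∉ K, Ψ =ᶠ[nhds z] fun _ => 0 := fun z hz => by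
    filter_upwards [hK.isClosed.isOpen_compl.mem_nhds hz] with y hy using hzero y hy
  have hhd : ∀ z ∈ Ω, DifferentiableAt ℂ h z := fun z hz =>
    hh.differentiableAt (hΩ.mem_nhds hz)
  have hhr : ∀ z ∈ Ω, DifferentiableAt ℝ h z := fun z hz => (hhd z hz).restrictScalars ℝ
  have hud : ∀ z ∈ Ω, DifferentiableAt ℝ u z := fun z hz =>
    (hu.differentiableOn (by simp)).differentiableAt (hΩ.mem_nhds hz)
  have hdiff : Differentiable ℝ Ψ := fun z => by
    by_cases hz : z ∈ K
    · exact ((hhr z (hKΩ hz)).mul (hud z (hKΩ hz))).congr_of_eventuallyEq (hnear z (hKΩ hz))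
    · exact (differentiableAt_const 0).congr_of_eventuallyEq (hoff z hz)
  have hsupp : ∀ w, ∀ z ∉ K, fderiv ℝ Ψ z w = 0 := fun w z hz => by
    rw [(hoff z hz).fderiv_eq]; simp
  have hint : Integrable Ψ :=
    hdiff.continuous.integrable_of_hasCompactSupport (HasCompactSupport.intro hK hzero)
  have hintd : ∀ w, Integrable fun z => fderiv ℝ Ψ z w := fun w => by
    obtain ⟨Ch, hCh⟩ := hK.exists_bound_of_continuousOn (hh.continuousOn.mono hKΩ)
    obtain ⟨Cu, hCu⟩ := hK.exists_bound_of_continuousOn (hu.continuousOn.mono hKΩ)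
    -- Boundedness on `K` and measurability suffice for integrability, so the Cauchy estimate is all
    -- that is needed about the derivative of `h`.
    obtain ⟨Ch', hCh'⟩ := exists_bound_fderiv_of_differentiableOn hΩ hK hKΩ hh w
    obtain ⟨Cu', hCu'⟩ := hK.exists_bound_of_continuousOn (f := fun z => fderiv ℝ u z w)
      ((((hu.continuousOn_fderiv_of_isOpen hΩ le_rfl)).mono hKΩ).clm_apply continuousOn_const)
    have hon : IntegrableOn (fun z => fderiv ℝ Ψ z w) K := by
      refine Measure.integrableOn_of_bounded (M := Ch * Cu' + Cu * Ch') hK.measure_lt_top.ne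
        (measurable_fderiv_apply_const ℝ Ψ w).aestronglyMeasurable ?_
      refine (ae_restrict_iff' hK.measurableSet).2 (Filter.Eventually.of_forall fun z hz => ?_)
      rw [(hnear z (hKΩ hz)).fderiv_eq, fderiv_fun_mul (hhr z (hKΩ hz)) (hud z (hKΩ hz))]
      simp only [add_apply, smul_apply, smul_eq_mul]
      refine (norm_add_le _ _).trans ?_
      rw [norm_mul, norm_mul]
      have h1 := (norm_nonneg _).trans (hCh z hz)
      have h2 := (norm_nonneg _).trans (hCu z hz)
      exact add_le_add (mul_le_mul (hCh z hz) (hCu' z hz) (norm_nonneg _) h1)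
        (mul_le_mul (hCu z hz) (hCh' z hz) (norm_nonneg _) h2)
    exact (integrableOn_iff_integrable_of_support_subset fun z hz => by
      by_contra hzK
      exact hz (hsupp w z hzK)).1 hon
  have htot : ∫ z, dbar v Ψ z = 0 := by
    simp only [dbar]
    rw [integral_add (hintd v) ((hintd _).const_mul _), integral_const_mul,
      integral_fderiv_apply_eq_zero hdiff hint (hintd v),
      integral_fderiv_apply_eq_zero hdiff hint (hintd _)]
    simp
  rw [← htot, ← setIntegral_eq_integral_of_forall_compl_eq_zero (s := Ω) (f := dbar v Ψ)]
  · refine setIntegral_congr_fun hΩ.measurableSet fun z hz => ?_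
    have h1 : dbar v Ψ z = dbar v (fun z => h z * u z) z := by
      simp only [dbar, (hnear z hz).fderiv_eq]
    simp only [h1, dbar_mul (hhr z hz) (hud z hz), dbar_eq_zero (hhd z hz), mul_zero, add_zero]
  · intro z hz
    have : z ∉ K := fun h => hz (hKΩ h)
    simp [dbar, hsupp _ z this]

/-- Domination. It carries the single assumption that `h δ^α` is integrable over to every other
integrand, each being bounded by a multiple of it. -/
theorem integrableOn_holomorphic_mul {Ω : Set (EuclideanSpace ℂ (Fin n))} (hΩ : IsOpen Ω)
    {h u f : EuclideanSpace ℂ (Fin n) → ℂ} {C : ℝ} (hh : DifferentiableOn ℂ h Ω)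
    (hu : ContinuousOn u Ω) (hf : IntegrableOn (fun z => h z * f z) Ω)
    (hle : ∀ z ∈ Ω, ‖u z‖ ≤ C * ‖f z‖) : IntegrableOn (fun z => h z * u z) Ω := by
  refine (hf.norm.const_mul C).mono'
    ((hh.continuousOn.mul hu).aestronglyMeasurable hΩ.measurableSet) ?_
  refine (ae_restrict_iff' hΩ.measurableSet).2 (Filter.Eventually.of_forall fun z hz => ?_)
  rw [norm_mul, norm_mul]
  calc ‖h z‖ * ‖u z‖ ≤ ‖h z‖ * (C * ‖f z‖) := by gcongr; exact hle z hz
    _ = _ := by ring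

theorem norm_ofReal_rpow {t : ℝ} (ht : 0 < t) (α : ℝ) : ‖((t ^ α : ℝ) : ℂ)‖ = t ^ α := by
  rw [Complex.norm_real, Real.norm_of_nonneg (Real.rpow_pos_of_pos ht α).le]

theorem continuousOn_ofReal_rpow {Ω : Set (EuclideanSpace ℂ (Fin n))}
    {δ : EuclideanSpace ℂ (Fin n) → ℝ} (hδ : ContinuousOn δ Ω) (hpos : ∀ z ∈ Ω, 0 < δ z) (α : ℝ) :
    ContinuousOn (fun z => ((δ z ^ α : ℝ) : ℂ)) Ω :=
  Complex.continuous_ofReal.comp_continuousOn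
    (hδ.rpow_const fun z hz => Or.inl (hpos z hz).ne')

/-- Integration by parts against a holomorphic function, without boundary term: the weight
`δ ^ (α + 1)` vanishes at the boundary. -/
theorem setIntegral_holomorphic_mul_dbar_weight_eq_zero {Ω : Set (EuclideanSpace ℂ (Fin n))}
    (hΩ : IsOpen Ω) {δ : EuclideanSpace ℂ (Fin n) → ℝ} (hδ : BoundedSmoothOn Ω δ)
    (hpos : ∀ z ∈ Ω, 0 < δ z)
    (hexh : ∀ ε > 0, ∃ K, IsCompact K ∧ K ⊆ Ω ∧ ∀ z ∈ Ω, z ∉ K → δ z < ε)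
    {α : ℝ} (hα : -1 < α) {F h : EuclideanSpace ℂ (Fin n) → ℂ} (hF : BoundedSmoothOn Ω F)
    (hh : DifferentiableOn ℂ h Ω)
    (hint : IntegrableOn (fun z => h z * ((δ z ^ α : ℝ) : ℂ)) Ω)
    (v : EuclideanSpace ℂ (Fin n)) :
    ∫ z in Ω, h z * (((δ z ^ (α + 1) : ℝ) : ℂ) * dbar v F z +
      F z * ((((α + 1) * δ z ^ α : ℝ) : ℂ) * dbar v (fun y => (δ y : ℂ)) z)) = 0 := by
  obtain ⟨C, θ, hC, hθs, hθ0, hθb, hθl⟩ := exists_truncated_rpow hα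
  obtain ⟨M, hM0, hM⟩ := hδ.exists_bound
  obtain ⟨A, hA0, hA⟩ := hF.exists_bound
  obtain ⟨A', hA0', hA'⟩ := (hF.dbar hΩ v).exists_bound
  have hdδ := (hδ.ofReal hΩ).dbar hΩ v
  obtain ⟨D, hD0, hD⟩ := hdδ.exists_bound
  have hδd : ∀ z ∈ Ω, DifferentiableAt ℝ δ z := fun z hz =>
    (hδ.1.differentiableOn (by simp)).differentiableAt (hΩ.mem_nhds hz)
  have hFd : ∀ z ∈ Ω, DifferentiableAt ℝ F z := fun z hz =>
    (hF.1.differentiableOn (by simp)).differentiableAt (hΩ.mem_nhds hz)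
  have hmaps : Set.MapsTo δ Ω (Set.Ioi 0) := fun z hz => hpos z hz
  have hθδ : ∀ m, ContDiffOn ℝ 1 (fun z => (θ m (δ z) : ℂ)) Ω := fun m =>
    Complex.ofRealCLM.contDiff.comp_contDiffOn
      ((hθs m).comp (hδ.1.of_le (by exact_mod_cast le_top)) hmaps)
  set Φ : ℕ → EuclideanSpace ℂ (Fin n) → ℂ := fun m z =>
    h z * ((θ m (δ z) : ℂ) * dbar v F z +
      F z * (((deriv (θ m) (δ z) : ℝ) : ℂ) * dbar v (fun y => (δ y : ℂ)) z)) with hΦ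
  -- `Φ m` is `h` times `dbar v` of `θ_m(δ) F`. This product vanishes where `δ` is small, hence off
  -- a compact subset of `Ω`, and the compactly supported case applies.
  have hΦ0 : ∀ m, ∫ z in Ω, Φ m z = 0 := fun m => by
    obtain ⟨ε, hε, hθε⟩ := hθ0 m
    obtain ⟨K, hK, hKΩ, hKε⟩ := hexh ε hε
    rw [← setIntegral_holomorphic_mul_dbar_eq_zero hΩ hK hKΩ hh
      (u := fun z => (θ m (δ z) : ℂ) * F z)
      ((hθδ m).mul (hF.1.of_le (by exact_mod_cast le_top)))
      (fun z hz hzK => by simp [hθε _ (hKε z hz hzK)]) v]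
    refine setIntegral_congr_fun hΩ.measurableSet fun z hz => ?_
    have h1 : DifferentiableAt ℝ (θ m) (δ z) :=
      ((hθs m).differentiableOn (by simp)).differentiableAt (Ioi_mem_nhds (hpos z hz))
    have h2 : DifferentiableAt ℝ (fun z => (θ m (δ z) : ℂ)) z :=
      ((hθδ m).differentiableOn (by simp)).differentiableAt (hΩ.mem_nhds hz)
    simp only [hΦ, dbar_mul h2 (hFd z hz), dbar_ofReal_comp (hδd z hz) h1]
  have hlim : Filter.Tendsto (fun m => ∫ z in Ω, Φ m z) Filter.atTop
      (nhds (∫ z in Ω, h z * (((δ z ^ (α + 1) : ℝ) : ℂ) * dbar v F z +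
      F z * ((((α + 1) * δ z ^ α : ℝ) : ℂ) * dbar v (fun y => (δ y : ℂ)) z)))) := by
    refine tendsto_integral_of_dominated_convergence
      (fun z => (M * A' + A * (C * D)) * ‖h z * ((δ z ^ α : ℝ) : ℂ)‖) (fun m => ?_)
      (hint.norm.const_mul _) (fun m => ?_) ?_
    · refine ContinuousOn.aestronglyMeasurable ?_ hΩ.measurableSet
      have h1 : ContinuousOn (fun z => ((deriv (θ m) (δ z) : ℝ) : ℂ)) Ω :=
        Complex.continuous_ofReal.comp_continuousOn
          (((hθs m).continuousOn_deriv_of_isOpen isOpen_Ioi le_rfl).comp hδ.1.continuousOn hmaps)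
      exact hh.continuousOn.mul (((hθδ m).continuousOn.mul (hF.dbar hΩ v).1.continuousOn).add
        (hF.1.continuousOn.mul (h1.mul hdδ.1.continuousOn)))
    · refine (ae_restrict_iff' hΩ.measurableSet).2 (Filter.Eventually.of_forall fun z hz => ?_)
      have hp := Real.rpow_pos_of_pos (hpos z hz) α
      have hδM : δ z ≤ M := (le_abs_self _).trans (hM z hz)
      -- Both terms of `Φ m` are dominated by `|h| δ^α`: here one factor of `δ^(α+1)` is absorbed in
      -- the bound `M` of `δ`, and `deriv (θ m)` is already controlled by `C δ^α`.
      have h1 : |θ m (δ z)| ≤ M * δ z ^ α := by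
        refine (hθb m _ (hpos z hz)).1.trans ?_
        rw [Real.rpow_add (hpos z hz), Real.rpow_one, mul_comm]
        gcongr
      have h2 := (hθb m _ (hpos z hz)).2
      rw [norm_mul, norm_mul, norm_ofReal_rpow (hpos z hz)]
      calc _ ≤ ‖h z‖ * (M * δ z ^ α * A' + A * (C * δ z ^ α * D)) := by
            gcongr
            refine (norm_add_le _ _).trans ?_
            rw [norm_mul, norm_mul, norm_mul, Complex.norm_real, Complex.norm_real,
              Real.norm_eq_abs, Real.norm_eq_abs]
            gcongr
            · exact hA' z hz
            · exact hA z hz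
            · exact hD z hz
        _ = _ := by ring
    · refine (ae_restrict_iff' hΩ.measurableSet).2 (Filter.Eventually.of_forall fun z hz => ?_)
      refine tendsto_const_nhds.congr' ?_
      filter_upwards [hθl _ (hpos z hz)] with m hm
      simp only [hΦ, hm.1, hm.2]
  simp only [hΦ0] at hlim
  exact tendsto_nhds_unique hlim tendsto_const_nhds

/-! ### Raising the exponent of the weight -/

/-- The squared norm of the gradient of a real function on `ℂⁿ`. -/
noncomputable def gradSq (δ : EuclideanSpace ℂ (Fin n) → ℝ) (z : EuclideanSpace ℂ (Fin n)) : ℝ :=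
  ∑ j, (fderiv ℝ δ z (EuclideanSpace.single j 1) ^ 2 +
    fderiv ℝ δ z (Complex.I • EuclideanSpace.single j 1) ^ 2)

/-- One integration by parts trades the weight `|∇δ|² δ ^ α` for `δ ^ (α + 1)`. -/
theorem exists_setIntegral_gradSq_weight_eq {Ω : Set (EuclideanSpace ℂ (Fin n))}
    (hΩ : IsOpen Ω) {δ : EuclideanSpace ℂ (Fin n) → ℝ} (hδ : BoundedSmoothOn Ω δ)
    (hpos : ∀ z ∈ Ω, 0 < δ z)
    (hexh : ∀ ε > 0, ∃ K, IsCompact K ∧ K ⊆ Ω ∧ ∀ z ∈ Ω, z ∉ K → δ z < ε)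
    {α : ℝ} (hα : -1 < α) {g : EuclideanSpace ℂ (Fin n) → ℂ} (hg : BoundedSmoothOn Ω g) :
    ∃ g' : EuclideanSpace ℂ (Fin n) → ℂ, BoundedSmoothOn Ω g' ∧
      ∀ h : EuclideanSpace ℂ (Fin n) → ℂ, DifferentiableOn ℂ h Ω →
        IntegrableOn (fun z => h z * ((δ z ^ α : ℝ) : ℂ)) Ω →
          ∫ z in Ω, h z * g z * (gradSq δ z : ℂ) * ((δ z ^ α : ℝ) : ℂ) =
            ∫ z in Ω, h z * g' z * ((δ z ^ (α + 1) : ℝ) : ℂ) := by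
  set e : Fin n → EuclideanSpace ℂ (Fin n) := fun j => EuclideanSpace.single j 1 with he
  -- `F_j` is `g` times the complex conjugate of `dbar (e j) δ`, so pairing with `dbar (e j) δ` and
  -- summing gives `g|∇δ|²`. Nothing is divided by `|∇δ|²`, which may vanish inside `Ω`.
  set F : Fin n → EuclideanSpace ℂ (Fin n) → ℂ := fun j z =>
    g z * ((fderiv ℝ δ z (e j) : ℂ) + -Complex.I * (fderiv ℝ δ z (Complex.I • e j) : ℂ)) with hFdef
  have hF : ∀ j, BoundedSmoothOn Ω (F j) := fun j =>
    hg.mul hΩ (((hδ.fderiv_apply hΩ _).ofReal hΩ).add hΩ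
      (((hδ.fderiv_apply hΩ _).ofReal hΩ).const_mul hΩ _))
  have hα0 : (((α + 1 : ℝ)) : ℂ) ≠ 0 := Complex.ofReal_ne_zero.2 (by linarith)
  have hG : BoundedSmoothOn Ω (fun z => ∑ j, dbar (e j) (F j) z) :=
    BoundedSmoothOn.sum _ hΩ fun j _ => (hF j).dbar hΩ (e j)
  refine ⟨fun z => -(((α + 1 : ℝ)) : ℂ)⁻¹ * ∑ j, dbar (e j) (F j) z, hG.const_mul hΩ _,
    fun h hh hint => ?_⟩
  have hδd : ∀ z ∈ Ω, DifferentiableAt ℝ δ z := fun z hz =>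
    (hδ.1.differentiableOn (by simp)).differentiableAt (hΩ.mem_nhds hz)
  obtain ⟨M, hM0, hM⟩ := hδ.exists_bound
  have hi1 : ∀ {u : EuclideanSpace ℂ (Fin n) → ℂ}, BoundedSmoothOn Ω u →
      IntegrableOn (fun z => h z * (((δ z ^ (α + 1) : ℝ) : ℂ) * u z)) Ω := fun {u} hu => by
    obtain ⟨A, hA0, hA⟩ := hu.exists_bound
    refine integrableOn_holomorphic_mul (C := M * A) hΩ hh
      ((continuousOn_ofReal_rpow hδ.1.continuousOn hpos _).mul hu.1.continuousOn) hint
      fun z hz => ?_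
    have hp := Real.rpow_pos_of_pos (hpos z hz) α
    have hδM : δ z ≤ M := (le_abs_self _).trans (hM z hz)
    have hδ0 := hpos z hz
    rw [norm_mul, norm_ofReal_rpow (hpos z hz), norm_ofReal_rpow (hpos z hz),
      Real.rpow_add (hpos z hz), Real.rpow_one]
    calc δ z ^ α * δ z * ‖u z‖ ≤ δ z ^ α * M * A := by gcongr; exact hA z hz
      _ = _ := by ring
  have hi2 : ∀ {u : EuclideanSpace ℂ (Fin n) → ℂ}, BoundedSmoothOn Ω u →
      IntegrableOn (fun z => h z * (((δ z ^ α : ℝ) : ℂ) * u z)) Ω := fun {u} hu => by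
    obtain ⟨A, hA0, hA⟩ := hu.exists_bound
    refine integrableOn_holomorphic_mul (C := A) hΩ hh
      ((continuousOn_ofReal_rpow hδ.1.continuousOn hpos _).mul hu.1.continuousOn) hint
      fun z hz => ?_
    rw [norm_mul, mul_comm A]
    gcongr
    exact hA z hz
  have hS : BoundedSmoothOn Ω (fun z => ∑ j, F j z * dbar (e j) (fun y => (δ y : ℂ)) z) :=
    BoundedSmoothOn.sum _ hΩ fun j _ => (hF j).mul hΩ ((hδ.ofReal hΩ).dbar hΩ (e j))
  have hgS : ∀ z ∈ Ω, ∑ j, F j z * dbar (e j) (fun y => (δ y : ℂ)) z =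
      g z * (gradSq δ z : ℂ) := fun z hz => by
    rw [gradSq, Complex.ofReal_sum, Finset.mul_sum]
    refine Finset.sum_congr rfl fun j _ => ?_
    rw [dbar_ofReal (hδd z hz), hFdef]
    push_cast
    linear_combination (-g z * (fderiv ℝ δ z (Complex.I • e j) : ℂ) ^ 2) * Complex.I_sq
  have key : ∫ z in Ω, (h z * (((δ z ^ (α + 1) : ℝ) : ℂ) * ∑ j, dbar (e j) (F j) z) +
      ((α + 1 : ℝ) : ℂ) * (h z * (((δ z ^ α : ℝ) : ℂ) *
        ∑ j, F j z * dbar (e j) (fun y => (δ y : ℂ)) z))) = 0 := by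
    rw [← Finset.sum_const_zero (s := (Finset.univ : Finset (Fin n))), ← Finset.sum_congr rfl
      fun j _ => setIntegral_holomorphic_mul_dbar_weight_eq_zero hΩ hδ hpos hexh hα (hF j) hh
        hint (e j), ← integral_finsetSum]
    · refine integral_congr_ae (Filter.Eventually.of_forall fun z => ?_)
      simp only [Finset.mul_sum, ← Finset.sum_add_distrib]
      refine Finset.sum_congr rfl fun j _ => ?_
      push_cast
      ring
    · intro j _
      refine ((hi1 ((hF j).dbar hΩ (e j))).add ((hi2 ((hF j).mul hΩ
        ((hδ.ofReal hΩ).dbar hΩ (e j)))).const_mul ((α + 1 : ℝ) : ℂ))).congr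
        (Filter.Eventually.of_forall fun z => ?_)
      simp only [Pi.add_apply]
      push_cast
      ring
  rw [integral_add (hi1 hG) ((hi2 hS).const_mul _), integral_const_mul] at key
  have e1 : ∫ z in Ω, h z * g z * (gradSq δ z : ℂ) * ((δ z ^ α : ℝ) : ℂ) =
      ∫ z in Ω, h z * (((δ z ^ α : ℝ) : ℂ) *
        ∑ j, F j z * dbar (e j) (fun y => (δ y : ℂ)) z) := by
    refine setIntegral_congr_fun hΩ.measurableSet fun z hz => ?_
    simp only [hgS z hz]
    ring
  have e2 : ∫ z in Ω, h z * (-(((α + 1 : ℝ)) : ℂ)⁻¹ * ∑ j, dbar (e j) (F j) z) *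
      ((δ z ^ (α + 1) : ℝ) : ℂ) = -(((α + 1 : ℝ)) : ℂ)⁻¹ *
      ∫ z in Ω, h z * (((δ z ^ (α + 1) : ℝ) : ℂ) * ∑ j, dbar (e j) (F j) z) := by
    rw [← integral_const_mul]
    congr 1 with z
    ring
  rw [e1, e2, eq_neg_of_add_eq_zero_left key, neg_mul_neg, inv_mul_cancel_left₀ hα0]

theorem memLp_top_of_continuousOn {Ω : Set (EuclideanSpace ℂ (Fin n))} (hΩ : IsOpen Ω)
    {w : EuclideanSpace ℂ (Fin n) → ℂ} {C : ℝ} (hw : ContinuousOn w Ω) (hC : ∀ z ∈ Ω, ‖w z‖ ≤ C) :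
    MemLp w ⊤ (volume.restrict Ω) :=
  memLp_top_of_bound (hw.aestronglyMeasurable hΩ.measurableSet) C
    ((ae_restrict_iff' hΩ.measurableSet).2 (Filter.Eventually.of_forall hC))

/-- Induction on the number `N` of integrations by parts, each raising `α` by one. For `N = 0` one
has `α ≥ k` and `w = g δ^(α-k)` is bounded. Otherwise `g|∇δ|²` is passed to the exponent `α + 1`,
and the remainder `r = g(1 - |∇δ|²)`, zero where `δ < c`, contributes `r δ^(α-k)` to `w`. -/
theorem exists_memLp_top_setIntegral_weight_eq {Ω : Set (EuclideanSpace ℂ (Fin n))}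
    (hΩ : IsOpen Ω) {δ : EuclideanSpace ℂ (Fin n) → ℝ} (hδ : BoundedSmoothOn Ω δ)
    (hpos : ∀ z ∈ Ω, 0 < δ z)
    (hexh : ∀ ε > 0, ∃ K, IsCompact K ∧ K ⊆ Ω ∧ ∀ z ∈ Ω, z ∉ K → δ z < ε)
    {c : ℝ} (hc : 0 < c) (hgrad : ∀ z ∈ Ω, δ z < c → gradSq δ z = 1)
    (k N : ℕ) {α : ℝ} (hα : -1 < α) (hN : k ≤ α + N) {g : EuclideanSpace ℂ (Fin n) → ℂ}
    (hg : BoundedSmoothOn Ω g) :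
    ∃ w : EuclideanSpace ℂ (Fin n) → ℂ, MemLp w ⊤ (volume.restrict Ω) ∧
      ∀ h : EuclideanSpace ℂ (Fin n) → ℂ, DifferentiableOn ℂ h Ω →
        IntegrableOn (fun z => h z * ((δ z ^ α : ℝ) : ℂ)) Ω volume →
          IntegrableOn (fun z => h z * w z * ((δ z ^ k : ℝ) : ℂ)) Ω volume ∧
          ∫ z in Ω, h z * g z * ((δ z ^ α : ℝ) : ℂ) =
            ∫ z in Ω, h z * w z * ((δ z ^ k : ℝ) : ℂ) := by
  obtain ⟨M, hM0, hM⟩ := hδ.exists_bound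
  have hδM : ∀ z ∈ Ω, δ z ≤ M := fun z hz => (le_abs_self _).trans (hM z hz)
  have hsplit : ∀ β : ℝ, ∀ z ∈ Ω, ((δ z ^ (β - k) : ℝ) : ℂ) * ((δ z ^ k : ℝ) : ℂ) =
      ((δ z ^ β : ℝ) : ℂ) := fun β z hz => by
    rw [← Complex.ofReal_mul, Real.rpow_sub (hpos z hz), Real.rpow_natCast,
      div_mul_cancel₀ _ (pow_pos (hpos z hz) k).ne']
  have hbdd : ∀ {β : ℝ} {u : EuclideanSpace ℂ (Fin n) → ℂ}, BoundedSmoothOn Ω u →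
      ∀ {h : EuclideanSpace ℂ (Fin n) → ℂ}, DifferentiableOn ℂ h Ω →
      IntegrableOn (fun z => h z * ((δ z ^ β : ℝ) : ℂ)) Ω →
      IntegrableOn (fun z => h z * (u z * ((δ z ^ β : ℝ) : ℂ))) Ω := by
    intro β u hu h hh hint
    obtain ⟨A, hA0, hA⟩ := hu.exists_bound
    refine integrableOn_holomorphic_mul (C := A) hΩ hh
      (hu.1.continuousOn.mul (continuousOn_ofReal_rpow hδ.1.continuousOn hpos _)) hint
      fun z hz => ?_
    rw [norm_mul]
    gcongr
    exact hA z hz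
  induction N generalizing α g with
  | zero =>
    obtain ⟨A, hA0, hA⟩ := hg.exists_bound
    refine ⟨fun z => g z * ((δ z ^ (α - k) : ℝ) : ℂ), memLp_top_of_continuousOn hΩ
      (C := A * M ^ (α - k)) (hg.1.continuousOn.mul
        (continuousOn_ofReal_rpow hδ.1.continuousOn hpos _)) fun z hz => ?_, fun h hh hint => ?_⟩
    · rw [norm_mul, norm_ofReal_rpow (hpos z hz)]
      have : 0 ≤ α - k := by simpa using hN
      have h0 := (hpos z hz).le
      gcongr
      · exact hA z hz
      · exact hδM z hz
    · have heq : Set.EqOn (fun z => h z * (g z * ((δ z ^ (α - k) : ℝ) : ℂ)) * ((δ z ^ k : ℝ) : ℂ))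
          (fun z => h z * g z * ((δ z ^ α : ℝ) : ℂ)) Ω := fun z hz => by
        simp only [← hsplit α z hz]; ring
      refine ⟨((hbdd hg hh hint).congr_fun (fun z hz => ?_) hΩ.measurableSet),
        (setIntegral_congr_fun hΩ.measurableSet heq).symm⟩
      simp only [← hsplit α z hz]; ring
  | succ N ih =>
    obtain ⟨g', hg', hg'eq⟩ := exists_setIntegral_gradSq_weight_eq hΩ hδ hpos hexh hα hg
    obtain ⟨w', hw', hw'eq⟩ := ih (α := α + 1) (by linarith) (by push_cast at hN; linarith) hg'
    have hgs : BoundedSmoothOn Ω (fun z => (gradSq δ z : ℂ)) := by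
      have := BoundedSmoothOn.sum Finset.univ hΩ fun (j : Fin n) _ =>
        (((hδ.fderiv_apply hΩ (EuclideanSpace.single j 1)).ofReal hΩ).mul hΩ
          ((hδ.fderiv_apply hΩ (EuclideanSpace.single j 1)).ofReal hΩ)).add hΩ
        (((hδ.fderiv_apply hΩ (Complex.I • EuclideanSpace.single j 1)).ofReal hΩ).mul hΩ
          ((hδ.fderiv_apply hΩ (Complex.I • EuclideanSpace.single j 1)).ofReal hΩ))
      refine this.congr fun z _ => ?_
      simp [gradSq, sq]
    have hrest : BoundedSmoothOn Ω (fun z => g z + -1 * (g z * (gradSq δ z : ℂ))) :=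
      hg.add hΩ ((hg.mul hΩ hgs).const_mul hΩ _)
    set r : EuclideanSpace ℂ (Fin n) → ℂ := fun z => g z + -1 * (g z * (gradSq δ z : ℂ)) with hr
    obtain ⟨A, hA0, hA⟩ := hrest.exists_bound
    have hw'' : MemLp (fun z => r z * ((δ z ^ (α - k) : ℝ) : ℂ)) ⊤ (volume.restrict Ω) := by
      -- The exponent `α - k` may be negative, but `r` lives where `c ≤ δ ≤ M`, and there the power
      -- is bounded. The interval may be empty and `B` negative, hence `max B 0` below.
      obtain ⟨B, hB⟩ := (isCompact_Icc (a := c) (b := M)).exists_bound_of_continuousOn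
        (f := fun t : ℝ => t ^ (α - k)) (continuousOn_id.rpow_const fun t ht =>
          Or.inl (hc.trans_le ht.1).ne')
      refine memLp_top_of_continuousOn hΩ (C := A * max B 0) (hrest.1.continuousOn.mul
        (continuousOn_ofReal_rpow hδ.1.continuousOn hpos _)) fun z hz => ?_
      rcases lt_or_ge (δ z) c with hlt | hge
      · have : r z = 0 := by simp [hr, hgrad z hz hlt]
        rw [this, zero_mul, norm_zero]
        positivity
      · rw [norm_mul, Complex.norm_real]
        exact mul_le_mul (hA z hz) ((hB _ ⟨hge, hδM z hz⟩).trans (le_max_left _ _))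
          (norm_nonneg _) hA0
    refine ⟨fun z => w' z + r z * ((δ z ^ (α - k) : ℝ) : ℂ), hw'.add hw'', fun h hh hint => ?_⟩
    have hint' : IntegrableOn (fun z => h z * ((δ z ^ (α + 1) : ℝ) : ℂ)) Ω := by
      refine integrableOn_holomorphic_mul (C := M) hΩ hh
        (continuousOn_ofReal_rpow hδ.1.continuousOn hpos _) hint fun z hz => ?_
      rw [norm_ofReal_rpow (hpos z hz), norm_ofReal_rpow (hpos z hz),
        Real.rpow_add (hpos z hz), Real.rpow_one, mul_comm]
      have := Real.rpow_pos_of_pos (hpos z hz) α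
      gcongr
      exact hδM z hz
    obtain ⟨hi, heq⟩ := hw'eq h hh hint'
    have hir := hbdd hrest hh hint
    have hig := hbdd (hg.mul hΩ hgs) hh hint
    have hsum : Set.EqOn (fun z => h z * (w' z + r z * ((δ z ^ (α - k) : ℝ) : ℂ)) *
        ((δ z ^ k : ℝ) : ℂ)) (fun z => h z * w' z * ((δ z ^ k : ℝ) : ℂ) +
          h z * (r z * ((δ z ^ α : ℝ) : ℂ))) Ω := fun z hz => by
      simp only [← hsplit α z hz]; ring
    refine ⟨(hi.add hir).congr_fun hsum.symm hΩ.measurableSet, ?_⟩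
    rw [setIntegral_congr_fun hΩ.measurableSet hsum, integral_add hi hir, ← heq,
      ← hg'eq h hh hint]
    rw [show (∫ z in Ω, h z * g z * (gradSq δ z : ℂ) * ((δ z ^ α : ℝ) : ℂ)) =
      ∫ z in Ω, h z * (g z * (gradSq δ z : ℂ) * ((δ z ^ α : ℝ) : ℂ)) by congr 1 with z; ring,
      ← integral_add hig hir]
    congr 1 with z
    simp only [hr]
    ring

end Dbar

/-! ### Verification for the given domain and weight -/

theorem mainTheorem10 {n : ℕ} (Ω : Set (EuclideanSpace ℂ (Fin n)))
    (hΩ : IsSmoothBoundedDomain Ω)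
    (δ : EuclideanSpace ℂ (Fin n) → ℝ) (hδ : SmoothUpToBoundary Ω δ)
    (hδ_pos : ∀ z ∈ Ω, 0 < δ z)
    (hδ_eq : ∃ U : Set (EuclideanSpace ℂ (Fin n)), IsOpen U ∧ frontier Ω ⊆ U ∧
      ∀ z ∈ U ∩ Ω, δ z = boundaryDist Ω z)
    (α : ℝ) (hα : -1 < α) (k : ℕ) (hk : 0 < k)
    (g : EuclideanSpace ℂ (Fin n) → ℂ) (hg : SmoothUpToBoundary Ω g) :
    ∃ w : EuclideanSpace ℂ (Fin n) → ℂ, MemLp w ⊤ (volume.restrict Ω) ∧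
      ∀ h : EuclideanSpace ℂ (Fin n) → ℂ, DifferentiableOn ℂ h Ω →
        IntegrableOn (fun z => h z * ((δ z ^ α : ℝ) : ℂ)) Ω volume →
          IntegrableOn (fun z => h z * g z * ((δ z ^ α : ℝ) : ℂ)) Ω volume ∧
          IntegrableOn (fun z => h z * w z * ((δ z ^ k : ℝ) : ℂ)) Ω volume ∧
          ∫ z in Ω, h z * g z * ((δ z ^ α : ℝ) : ℂ) = ∫ z in Ω, h z * w z * ((δ z ^ k : ℝ) : ℂ) := by
  have hO := hΩ.isOpen
  have hδB := hδ.boundedSmoothOn hO hΩ.isBounded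
  have hgB := hg.boundedSmoothOn hO hΩ.isBounded
  obtain ⟨U, hU, hfU, hUeq⟩ := hδ_eq
  have hcl : IsCompact (closure Ω) := hΩ.isBounded.isCompact_closure
  have hmem : ∀ z ∈ closure Ω, z ∉ frontier Ω → z ∈ Ω := fun z hz hzf => by
    rw [hO.frontier_eq] at hzf
    by_contra h
    exact hzf ⟨hz, h⟩
  have hK0 : IsCompact (closure Ω \ U) := hcl.diff hU
  have hK0Ω : closure Ω \ U ⊆ Ω := fun z hz => hmem z hz.1 fun h => hz.2 (hfU h)
  have hexh : ∀ ε > 0, ∃ K, IsCompact K ∧ K ⊆ Ω ∧ ∀ z ∈ Ω, z ∉ K → δ z < ε := by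
    intro ε hε
    -- Off the first set `δ` is the distance to the boundary; off the second that distance is less
    -- than `ε`. Both are closed in the compact closure and avoid the boundary.
    refine ⟨(closure Ω \ U) ∪ (closure Ω ∩ {z | ε ≤ Metric.infDist z (frontier Ω)}),
      hK0.union (hcl.inter_right (isClosed_le continuous_const
        (Metric.continuous_infDist_pt _))), Set.union_subset hK0Ω ?_, fun z hz hzK => ?_⟩
    · rintro z ⟨hz, hzε⟩
      refine hmem z hz fun h => ?_
      have : ε ≤ Metric.infDist z (frontier Ω) := hzε
      rw [Metric.infDist_zero_of_mem h] at this
      linarith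
    · rw [Set.mem_union, not_or] at hzK
      have hzU : z ∈ U := by
        by_contra h
        exact hzK.1 ⟨subset_closure hz, h⟩
      rw [hUeq z ⟨hzU, hz⟩]
      by_contra h
      exact hzK.2 ⟨subset_closure hz, not_lt.1 h⟩
  have hgrad : ∀ z ∈ U ∩ Ω, gradSq δ z = 1 := fun z hz =>
    sum_sq_fderiv_eq_one_of_eventuallyEq_infDist isClosed_frontier
      ((hδB.1.differentiableOn (by simp)).differentiableAt (hO.mem_nhds hz.2)) (hδ_pos z hz.2)
      (by filter_upwards [(hU.inter hO).mem_nhds hz] with y hy using hUeq y hy)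
  -- `c` is the minimum of `δ` on the compact part of `Ω` outside `U`, so `δ z < c` forces `z ∈ U`,
  -- where the eikonal equation holds. If that part is empty, any `c > 0` will do.
  obtain ⟨c, hc, hcK⟩ : ∃ c > 0, ∀ z ∈ closure Ω \ U, c ≤ δ z := by
    rcases (closure Ω \ U).eq_empty_or_nonempty with h | h
    · exact ⟨1, one_pos, by simp [h]⟩
    · obtain ⟨x, hx, hxm⟩ := hK0.exists_isMinOn h (hδB.1.continuousOn.mono hK0Ω)
      exact ⟨δ x, hδ_pos x (hK0Ω hx), fun z hz => hxm hz⟩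
  have hgradc : ∀ z ∈ Ω, δ z < c → gradSq δ z = 1 := fun z hz hzc => by
    refine hgrad z ⟨?_, hz⟩
    by_contra h
    exact absurd (hcK z ⟨subset_closure hz, h⟩) (not_le.2 hzc)
  obtain ⟨N, hN⟩ := exists_nat_ge ((k : ℝ) - α)
  obtain ⟨w, hw, hweq⟩ := exists_memLp_top_setIntegral_weight_eq hO hδB hδ_pos hexh hc hgradc k N
    hα (by linarith) hgB
  refine ⟨w, hw, fun h hh hint => ⟨?_, hweq h hh hint⟩⟩
  obtain ⟨A, hA0, hA⟩ := hgB.exists_bound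
  refine (integrableOn_holomorphic_mul (C := A) (u := fun z => g z * ((δ z ^ α : ℝ) : ℂ)) hO hh
    (hgB.1.continuousOn.mul (continuousOn_ofReal_rpow hδB.1.continuousOn hδ_pos _)) hint
    fun z hz => ?_).congr_fun (fun z _ => by simp only [mul_assoc]) hO.measurableSet
  rw [norm_mul]
  gcongr
  exact hA z hz
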